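/- Let $R$ be a commutative ring with unity, and write $(-)^C=\operatorname{Hom}_R(-,C)$. Let $C$ be a semidualizing $R$-module, that is: $C$ has a resolution $\cdots\to P_1\to P_0\to C\to 0$ by finitely generated projective modules, the homothety map $R\to\operatorname{Hom}_R(C,C)$ is an isomorphism, and $\operatorname{Ext}^i_R(C,C)=0$ for all $i\ge 1$. An $R$-module $M$ is called $G_C$-projective if there is an exact sequence $$\mathbb X=\cdots\to P_1\to P_0\to C\otimes_R P_{-1}\to C\otimes_R P_{-2}\to\cdots$$ with all $P_i$ projective such that $M\cong\operatorname{im}(P_0\to C\otimes_R P_{-1})$ and $\operatorname{Hom}_R(\mathbb X,C\otimes_R P)$ is exact for every projective $R$-module $P$. Suppose that every finitely generated submodule of a $G_C$-projective $R$-module is $G_C$-projective. Then $R$ is coherent, i.e. every finitely generated ideal of $R$ is finitely presented. Moreover, for every finitely generated ideal $M$ of $R$ the natural map $M\to M^{CC}$ is an isomorphism, and $M^{CC}$ belongs to $\operatorname{gen}^*(R)$, i.e. there is an exact sequence $\cdots\to T_1\to T_0\to M^{CC}\to 0$ with each $T_i$ a direct summand of a finite direct sum of copies of $R$ which remains exact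 under $\operatorname{Hom}_R(R,-)$. -/

import Mathlib

open scoped TensorProduct

universe u

section HomologicalNotions

variable (R : Type u) [CommRing R]

/-- For linear maps `f : A → B` and `g : B → D`, the sequence
`Hom(D, N) → Hom(B, N) → Hom(A, N)` is exact at `Hom(B, N)`. -/
def ContraHomExact (N : Type u) [AddCommGroup N] [Module R N]
    {A B D : Type u} [AddCommGroup A] [Module R A] [AddCommGroup B] [Module R B]
    [AddCommGroup D] [Module R D] (f : A →ₗ[R] B) (g : B →ₗ[R] D) : Prop :=
  Function.Exact (fun φ : D →ₗ[R] N => φ ∘ₗ g) (fun φ : B →ₗ[R] N => φ ∘ₗ f)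

/-- For linear maps `f : A → B` and `g : B → D`, the sequence
`Hom(T, A) → Hom(T, B) → Hom(T, D)` is exact at `Hom(T, B)`. -/
def CoHomExact (T : Type u) [AddCommGroup T] [Module R T]
    {A B D : Type u} [AddCommGroup A] [Module R A] [AddCommGroup B] [Module R B]
    [AddCommGroup D] [Module R D] (f : A →ₗ[R] B) (g : B →ₗ[R] D) : Prop :=
  Function.Exact (fun φ : T →ₗ[R] A => f ∘ₗ φ) (fun φ : T →ₗ[R] B => g ∘ₗ φ)

/-- `M` has a resolution `⋯ → P₁ → P₀ → M → 0` by finitely generated projective modules. -/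
def HasDegreewiseFiniteProjectiveResolution
    (M : Type u) [AddCommGroup M] [Module R M] : Prop :=
  ∃ (P : ℕ → ModuleCat.{u} R) (d : ∀ n, P (n + 1) →ₗ[R] P n) (ε : P 0 →ₗ[R] M),
    (∀ n, Module.Finite R (P n) ∧ Module.Projective R (P n)) ∧
    Function.Surjective ε ∧
    Function.Exact (d 0) ε ∧
    ∀ n, Function.Exact (d (n + 1)) (d n)

/-- Semidualizing modules. -/
structure IsSemidualizing (C : Type u) [AddCommGroup C] [Module R C] : Prop where
  resolution : HasDegreewiseFiniteProjectiveResolution R C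
  homothety : Function.Bijective (LinearMap.lsmul R C : R →ₗ[R] C →ₗ[R] C)
  ext_eq_zero : ∀ i : ℕ, 1 ≤ i →
    Subsingleton (CategoryTheory.Abelian.Ext.{u} (ModuleCat.of R C) (ModuleCat.of R C) i)

/-- `M` is `G_C`-projective: there is an exact sequence
`X = ⋯ → P₁ → P₀ → C ⊗ Q₀ → C ⊗ Q₁ → ⋯` with all `Pₙ`, `Qₙ` projective
(`Qₙ` is the module usually written `P₋ₙ₋₁`), such that `M` is isomorphic to the image of
`P₀ → C ⊗ Q₀` and `Hom(X, C ⊗ L)` is exact for every projective module `L`. -/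
def IsGCProjective (C : Type u) [AddCommGroup C] [Module R C]
    (M : Type u) [AddCommGroup M] [Module R M] : Prop :=
  ∃ (P Q : ℕ → ModuleCat.{u} R)
    (d : ∀ n, P (n + 1) →ₗ[R] P n)
    (e : P 0 →ₗ[R] C ⊗[R] Q 0)
    (δ : ∀ n, C ⊗[R] Q n →ₗ[R] C ⊗[R] Q (n + 1)),
    (∀ n, Module.Projective R (P n)) ∧
    (∀ n, Module.Projective R (Q n)) ∧
    -- exactness of `X`
    ((∀ n, Function.Exact (d (n + 1)) (d n)) ∧
      Function.Exact (d 0) e ∧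
      Function.Exact e (δ 0) ∧
      (∀ n, Function.Exact (δ n) (δ (n + 1)))) ∧
    Nonempty (M ≃ₗ[R] LinearMap.range e) ∧
    -- exactness of `Hom(X, C ⊗ L)`
    ∀ (L : Type u) [AddCommGroup L] [Module R L], Module.Projective R L →
      (∀ n, ContraHomExact R (C ⊗[R] L) (d (n + 1)) (d n)) ∧
      ContraHomExact R (C ⊗[R] L) (d 0) e ∧
      ContraHomExact R (C ⊗[R] L) e (δ 0) ∧
      (∀ n, ContraHomExact R (C ⊗[R] L) (δ n) (δ (n + 1)))

/-- `M ∈ add T`: `M` is isomorphic to a direct summand of some `Tⁿ`, expressed by a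
split monomorphism `M → Tⁿ`. -/
def InAdd (T : Type u) [AddCommGroup T] [Module R T]
    (M : Type u) [AddCommGroup M] [Module R M] : Prop :=
  ∃ (n : ℕ) (i : M →ₗ[R] (Fin n → T)) (p : (Fin n → T) →ₗ[R] M), p ∘ₗ i = LinearMap.id

/-- `M ∈ gen*(T)`: there is an exact sequence `⋯ → T₁ → T₀ → M → 0` with all
`Tₙ ∈ add T` that stays exact under `Hom(T, -)`. -/
def InGenStar (T : Type u) [AddCommGroup T] [Module R T]
    (M : Type u) [AddCommGroup M] [Module R M] : Prop :=
  ∃ (X : ℕ → ModuleCat.{u} R) (d : ∀ n, X (n + 1) →ₗ[R] X n) (ε : X 0 →ₗ[R] M),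
    (∀ n, InAdd R T (X n)) ∧
    (Function.Surjective ε ∧
      Function.Exact (d 0) ε ∧
      ∀ n, Function.Exact (d (n + 1)) (d n)) ∧
    (Function.Surjective (fun φ : T →ₗ[R] X 0 => ε ∘ₗ φ) ∧
      CoHomExact R T (d 0) ε ∧
      ∀ n, CoHomExact R T (d (n + 1)) (d n))

/-- A commutative ring is coherent if its finitely generated ideals are finitely presented. -/
def IsCoherentRing : Prop :=
  ∀ I : Ideal R, I.FG → Module.FinitePresentation R I

/-- The biduality map `M → Hom(Hom(M, C), C)`, `m ↦ (φ ↦ φ m)`. -/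
def bidualityMap (C : Type u) [AddCommGroup C] [Module R C]
    (M : Type u) [AddCommGroup M] [Module R M] :
    M →ₗ[R] (M →ₗ[R] C) →ₗ[R] C :=
  (LinearMap.id : (M →ₗ[R] C) →ₗ[R] (M →ₗ[R] C)).flip

end HomologicalNotions

/-! Let `X` be a finitely generated `G_C`-projective module. Its copy in `C ⊗ Q₀` only meets
finitely many coordinates, so the right half of the defining complex can be cut down to an exact `0
→ X → C^n → C^m × C^n` that stays exact under `Hom(-, C)`
(`IsGCProjective.exists_finiteCopresentation`). By homothety `Hom(C^n, C) = R^n`, so dualizing once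
presents `X^C` finitely, and dualizing twice gives `X ≅ X^CC`.

It remains to present `X` itself. A surjection `R^k → X` embeds `X^C` in `C^k`, which is
`G_C`-projective. As `X^C` is finitely generated, the hypothesis makes it `G_C`-projective too, and
the previous paragraph applied to `X^C` shows that `X^CC ≅ X` is finitely presented
(`IsSemidualizing.bijective_and_finitePresentation`).

Since `R` is `G_C`-projective, this covers every finitely generated ideal. Over the resulting
coherent ring, finitely presented modules have finite free resolutions, which `Hom(R, -)` keeps
exact. -/

/-! ### Reduction to finite powers of `C` -/

section FiniteFactor

variable {R : Type u} [CommRing R]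

/-- A finite subset of a projective module is fixed by an endomorphism factoring through a finite
free module. -/
lemma Module.Projective.exists_finite_free_factor (Q : Type u) [AddCommGroup Q] [Module R Q]
    [Module.Projective R Q] (N : Submodule R Q) (hN : N.FG) :
    ∃ (n : ℕ) (v : Q →ₗ[R] (Fin n → R)) (w : (Fin n → R) →ₗ[R] Q), ∀ x ∈ N, w (v x) = x := by
  classical
  obtain ⟨s, hs⟩ := Module.projective_def'.mp ‹Module.Projective R Q›
  obtain ⟨t, rfl⟩ := hN
  -- `s` splits the free cover of `Q`; only the basis elements in `S` are needed to write `s q` for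
  -- the generators `q`.
  let S : Finset Q := t.biUnion fun q => (s q).support
  let i := S.equivFin
  refine ⟨S.card, LinearMap.pi fun k => Finsupp.lapply (i.symm k : Q) ∘ₗ s,
    Fintype.linearCombination R (fun k => (i.symm k : Q)), fun x hx => ?_⟩
  induction hx using Submodule.span_induction with
  | mem q hq =>
    have h1 := LinearMap.congr_fun hs q
    simp only [LinearMap.comp_apply, LinearMap.id_apply, Finsupp.linearCombination_apply, id] at h1
    rw [Finsupp.sum_of_support_subset (s := S) _
      (fun y hy => Finset.mem_biUnion.mpr ⟨q, hq, hy⟩) _ (by simp)] at h1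
    conv_rhs => rw [← h1]
    rw [Fintype.linearCombination_apply, ← Finset.sum_coe_sort S, ← i.symm.sum_comp]
    rfl
  | zero => simp
  | add x y _ _ hx hy => rw [map_add, map_add, hx, hy]
  | smul r x _ hx => rw [map_smul, map_smul, hx]

/-- A map from a finitely generated module to `C ⊗ Q`, `Q` projective, factors through
a finite power of `C` by maps defined on all of `C ⊗ Q`. -/
lemma exists_finite_power_factor (C : Type u) [AddCommGroup C] [Module R C]
    (Q : Type u) [AddCommGroup Q] [Module R Q] [Module.Projective R Q]
    {Y : Type u} [AddCommGroup Y] [Module R Y] [Module.Finite R Y] (g : Y →ₗ[R] C ⊗[R] Q) :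
    ∃ (n : ℕ) (v : C ⊗[R] Q →ₗ[R] (Fin n → C)) (w : (Fin n → C) →ₗ[R] C ⊗[R] Q),
      ∀ y, w (v (g y)) = g y := by
  obtain ⟨t, ht⟩ := (Module.Finite.fg_top : (⊤ : Submodule R Y).FG)
  obtain ⟨N, hN, hsub⟩ := TensorProduct.exists_finite_submodule_right_of_setFinite
    (g '' (t : Set Y)) (t.finite_toSet.image g)
  obtain ⟨n, v, w, hvw⟩ := Module.Projective.exists_finite_free_factor Q N
    (Module.Finite.iff_fg.mp hN)
  let e := TensorProduct.piScalarRight R R C (Fin n)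
  refine ⟨n, e.toLinearMap ∘ₗ v.lTensor C, w.lTensor C ∘ₗ e.symm.toLinearMap, fun y => ?_⟩
  have hy : y ∈ Submodule.span R (t : Set Y) := ht ▸ Submodule.mem_top
  -- `g` sends generators of `Y` into the image of `C ⊗ N`, where the endomorphism is the identity.
  have key : (w.lTensor C ∘ₗ v.lTensor C) ∘ₗ N.subtype.lTensor C = N.subtype.lTensor C := by
    rw [← LinearMap.lTensor_comp, ← LinearMap.lTensor_comp]
    congr 1
    ext x
    exact hvw x x.2
  simp only [LinearMap.comp_apply, LinearEquiv.coe_coe, LinearEquiv.symm_apply_apply]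
  induction hy using Submodule.span_induction with
  | mem y hy =>
    obtain ⟨z, hz⟩ := hsub ⟨y, hy, rfl⟩
    rw [← hz]
    exact LinearMap.congr_fun key z
  | zero => simp
  | add x y _ _ hx hy => rw [map_add, map_add, map_add, hx, hy]
  | smul r x _ hx => rw [map_smul, map_smul, map_smul, hx]

variable {N : Type u} [AddCommGroup N] [Module R N]
variable {A B D : Type u} [AddCommGroup A] [Module R A] [AddCommGroup B] [Module R B]
  [AddCommGroup D] [Module R D]

lemma contraHomExact_iff {f : A →ₗ[R] B} {g : B →ₗ[R] D} :
    ContraHomExact R N f g ↔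
      (∀ ψ : D →ₗ[R] N, ∀ a, ψ (g (f a)) = 0) ∧
      ∀ φ : B →ₗ[R] N, (∀ a, φ (f a) = 0) → ∃ ψ : D →ₗ[R] N, ∀ b, ψ (g b) = φ b := by
  constructor
  · intro h
    refine ⟨fun ψ a => LinearMap.congr_fun ((h (ψ ∘ₗ g)).mpr ⟨ψ, rfl⟩) a, fun φ hφ => ?_⟩
    obtain ⟨ψ, hψ⟩ := (h φ).mp (LinearMap.ext hφ)
    exact ⟨ψ, LinearMap.congr_fun hψ⟩
  · rintro ⟨h0, h⟩ φ
    refine ⟨fun hφ => ?_, ?_⟩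
    · obtain ⟨ψ, hψ⟩ := h φ (LinearMap.congr_fun hφ)
      exact ⟨ψ, LinearMap.ext hψ⟩
    · rintro ⟨ψ, rfl⟩
      exact LinearMap.ext (h0 ψ)

lemma contraHomExact_of_exact {f : A →ₗ[R] B} {g : B →ₗ[R] D} (hfg : Function.Exact f g)
    (h : ∀ φ : B →ₗ[R] N, (∀ a, φ (f a) = 0) → ∃ ψ : D →ₗ[R] N, ∀ b, ψ (g b) = φ b) :
    ContraHomExact R N f g :=
  contraHomExact_iff.mpr ⟨fun ψ a => by rw [hfg.apply_apply_eq_zero, map_zero], h⟩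

/-- Exactness under `Hom(-, C)` implies exactness under `Hom(-, C ⊗ L)`, `L` projective, when the
middle module is finitely generated. -/
lemma ContraHomExact.tensor {C : Type u} [AddCommGroup C] [Module R C] [Module.Finite R B]
    {f : A →ₗ[R] B} {g : B →ₗ[R] D} (hfg : Function.Exact f g) (h : ContraHomExact R C f g)
    (L : Type u) [AddCommGroup L] [Module R L] [Module.Projective R L] :
    ContraHomExact R (C ⊗[R] L) f g := by
  refine contraHomExact_of_exact hfg fun φ hφ => ?_
  obtain ⟨n, v, w, hvw⟩ := exists_finite_power_factor C L φ
  have := fun k => (contraHomExact_iff.mp h).2 (LinearMap.proj k ∘ₗ v ∘ₗ φ)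
    (fun a => by simp [hφ])
  choose ψ hψ using this
  refine ⟨w ∘ₗ LinearMap.pi ψ, fun b => ?_⟩
  rw [← hvw b, LinearMap.comp_apply]
  congr 1
  ext k
  simpa using hψ k b

end FiniteFactor

/-! ### Finite copresentations and `C`-duality -/

section Duality

variable {R : Type u} [CommRing R] {C : Type u} [AddCommGroup C] [Module R C]

lemma exists_smul_of_homothety (hC : Function.Bijective (LinearMap.lsmul R C : R →ₗ[R] C →ₗ[R] C))
    {n : ℕ} (f : (Fin n → C) →ₗ[R] C) : ∃ r : Fin n → R, ∀ c, f c = ∑ k, r k • c k := by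
  classical
  choose r hr using fun k => hC.2 (f ∘ₗ LinearMap.single R (fun _ => C) k)
  refine ⟨r, fun c => ?_⟩
  conv_lhs => rw [← Finset.univ_sum_single c, map_sum]
  refine Finset.sum_congr rfl fun k _ => ?_
  exact (LinearMap.congr_fun (hr k) (c k)).symm

/-- A copresentation of `X` by finite powers of `C` that stays exact under `Hom(-, C)`. -/
structure FiniteCopresentation (R : Type u) [CommRing R] (C : Type u) [AddCommGroup C] [Module R C]
    (X : Type u) [AddCommGroup X] [Module R X] where
  n : ℕ
  m : ℕ
  a : X →ₗ[R] (Fin n → C)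
  b : (Fin n → C) →ₗ[R] (Fin m → C) × (Fin n → C)
  injective : Function.Injective a
  exact : Function.Exact a b
  extend : ∀ φ : X →ₗ[R] C, ∃ ψ : (Fin n → C) →ₗ[R] C, ∀ x, ψ (a x) = φ x
  factor : ∀ φ : (Fin n → C) →ₗ[R] C, (∀ x, φ (a x) = 0) →
    ∃ ψ : (Fin m → C) × (Fin n → C) →ₗ[R] C, ∀ c, ψ (b c) = φ c

/-- Both `X → C ⊗ Q₀` and the restriction of `δ 0` to `C^n` factor through finite powers of `C`.
Exactness under `Hom(-, C)` is the case `L = R`. -/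
lemma IsGCProjective.exists_finiteCopresentation [Module.Finite R C]
    {X : Type u} [AddCommGroup X] [Module R X] [Module.Finite R X] (hX : IsGCProjective R C X) :
    Nonempty (FiniteCopresentation R C X) := by
  obtain ⟨P, Q, d, e, δ, -, hQ, ⟨-, hde, he, -⟩, ⟨i⟩, hL⟩ := hX
  obtain ⟨-, hex, hfac, -⟩ := hL R inferInstance
  have ρ := TensorProduct.rid R C
  have := hQ 0
  have := hQ 1
  let j : X →ₗ[R] C ⊗[R] Q 0 := (LinearMap.range e).subtype ∘ₗ i.toLinearMap
  have hj : Function.Injective j := Subtype.val_injective.comp i.injective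
  have hje : ∀ x, ∃ p, e p = j x := fun x => (i x).2
  have hej : ∀ p, ∃ x, j x = e p := fun p => by
    obtain ⟨x, hx⟩ := i.surjective ⟨e p, p, rfl⟩
    exact ⟨x, by simp [j, hx]⟩
  have hδj : ∀ x, δ 0 (j x) = 0 := fun x => by
    obtain ⟨p, hp⟩ := hje x
    rw [← hp, he.apply_apply_eq_zero]
  obtain ⟨n, v, w, hvw⟩ := exists_finite_power_factor C (Q 0) j
  obtain ⟨m, v', w', hvw'⟩ := exists_finite_power_factor C (Q 1) (δ 0 ∘ₗ w)
  -- The second component forces `c = v (w c)`, cutting out the part of `C^n` that comes from `C ⊗ Q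
  -- 0`; the first detects `δ 0`.
  refine ⟨⟨n, m, v ∘ₗ j, (v' ∘ₗ δ 0 ∘ₗ w).prod (LinearMap.id - v ∘ₗ w), ?_, ?_, ?_, ?_⟩⟩
  · intro x y hxy
    apply hj
    rw [← hvw x, ← hvw y]
    exact congrArg w hxy
  · intro c
    constructor
    · intro hc
      have h1 : v' (δ 0 (w c)) = 0 := congrArg Prod.fst hc
      have h2 : c - v (w c) = 0 := congrArg Prod.snd hc
      have h3 : δ 0 (w c) = 0 := by
        have := hvw' c
        simp only [LinearMap.comp_apply, h1, map_zero] at this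
        exact this.symm
      obtain ⟨p, hp⟩ := (he _).mp h3
      obtain ⟨x, hx⟩ := hej p
      refine ⟨x, ?_⟩
      rw [LinearMap.comp_apply, hx, hp]
      exact (sub_eq_zero.mp h2).symm
    · rintro ⟨x, rfl⟩
      simp [hvw, hδj]
  · intro φ
    -- Pulled back to `P 0`, `φ` kills the image of `d 0`, hence factors through `e`.
    obtain ⟨ψ, hψ⟩ := (contraHomExact_iff.mp hex).2
      (ρ.symm.toLinearMap ∘ₗ φ ∘ₗ i.symm.toLinearMap ∘ₗ e.rangeRestrict) (fun p => by
        have : e.rangeRestrict (d 0 p) = 0 := Subtype.ext (hde.apply_apply_eq_zero p)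
        simp [this])
    refine ⟨ρ.toLinearMap ∘ₗ ψ ∘ₗ w, fun x => ?_⟩
    obtain ⟨p, hp⟩ := hje x
    have h1 : e.rangeRestrict p = i x := Subtype.ext hp
    have h2 := hψ p
    simp only [LinearMap.comp_apply, LinearEquiv.coe_coe, h1, LinearEquiv.symm_apply_apply] at h2 ⊢
    rw [hvw, ← hp, h2, LinearEquiv.apply_symm_apply]
  · intro φ hφ
    obtain ⟨ψ, hψ⟩ := (contraHomExact_iff.mp hfac).2 (ρ.symm.toLinearMap ∘ₗ φ ∘ₗ v) (fun p => by
      obtain ⟨x, hx⟩ := hej p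
      have := hφ x
      simp only [LinearMap.comp_apply] at this ⊢
      rw [← hx, this, map_zero])
    -- This uses `φ c = φ (v (w c)) + φ (c - v (w c))`.
    refine ⟨(ρ.toLinearMap ∘ₗ ψ ∘ₗ w').coprod φ, fun c => ?_⟩
    have h1 := hvw' c
    have h2 := hψ (w c)
    simp only [LinearMap.comp_apply] at h1 h2
    simp [h1, h2]

namespace FiniteCopresentation

variable {X : Type u} [AddCommGroup X] [Module R X]

/-- Every map `C^n → C` is a combination of coordinates, so `Φ` is evaluation at the point `c` of
its values on the coordinates of `a`. Testing against maps through `b` puts `c` in the image of `a`.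
-/
lemma biduality_bijective (S : FiniteCopresentation R C X)
    (hC : Function.Bijective (LinearMap.lsmul R C : R →ₗ[R] C →ₗ[R] C)) :
    Function.Bijective (bidualityMap R C X) := by
  constructor
  · rw [injective_iff_map_eq_zero]
    intro x hx
    apply S.injective
    rw [map_zero]
    ext k
    exact LinearMap.congr_fun hx (LinearMap.proj k ∘ₗ S.a)
  · intro Φ
    let c : Fin S.n → C := fun k => Φ (LinearMap.proj k ∘ₗ S.a)
    have hc : ∀ f : (Fin S.n → C) →ₗ[R] C, Φ (f ∘ₗ S.a) = f c := by
      intro f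
      obtain ⟨r, hr⟩ := exists_smul_of_homothety hC f
      have : f ∘ₗ S.a = ∑ k, r k • (LinearMap.proj k ∘ₗ S.a) := by
        ext x
        simp [hr]
      rw [this, hr, map_sum]
      simp [c]
    have hb : ∀ ψ : (Fin S.m → C) × (Fin S.n → C) →ₗ[R] C, ψ (S.b c) = 0 := by
      intro ψ
      have h1 := hc (ψ ∘ₗ S.b)
      have h2 : (ψ ∘ₗ S.b) ∘ₗ S.a = 0 := by
        ext x
        simp [S.exact.apply_apply_eq_zero]
      rw [h2, map_zero] at h1
      exact h1.symm
    have hbc : S.b c = 0 := by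
      refine Prod.ext (funext fun k => ?_) (funext fun k => ?_)
      · exact hb (LinearMap.proj k ∘ₗ LinearMap.fst R _ _)
      · exact hb (LinearMap.proj k ∘ₗ LinearMap.snd R _ _)
    obtain ⟨x, hx⟩ := (S.exact c).mp hbc
    refine ⟨x, LinearMap.ext fun φ => ?_⟩
    obtain ⟨ψ, hψ⟩ := S.extend φ
    have : φ = ψ ∘ₗ S.a := LinearMap.ext fun y => (hψ y).symm
    rw [this, hc, ← hx]
    rfl

/-- Dualizing the copresentation gives an exact `Hom(C^m × C^n, C) → Hom(C^n, C) → X^C → 0`, whose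
middle term is free of rank `n` and whose first term is finitely generated. -/
lemma dual_finitePresentation (S : FiniteCopresentation R C X)
    (hC : Function.Bijective (LinearMap.lsmul R C : R →ₗ[R] C →ₗ[R] C)) :
    Module.FinitePresentation R (X →ₗ[R] C) := by
  let σ (n : ℕ) : (Fin n → R) →ₗ[R] ((Fin n → C) →ₗ[R] C) :=
    Fintype.linearCombination R fun k => LinearMap.proj k
  have hσ : ∀ n, Function.Surjective (σ n) := fun n f => by
    obtain ⟨r, hr⟩ := exists_smul_of_homothety hC f
    exact ⟨r, LinearMap.ext fun c => by simp [σ, Fintype.linearCombination_apply, hr]⟩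
  let α := S.a.lcomp R C
  have hα : Function.Surjective α := fun φ => by
    obtain ⟨ψ, hψ⟩ := S.extend φ
    exact ⟨ψ, LinearMap.ext hψ⟩
  have hσinj : Function.Injective (σ S.n) := by
    classical
    rw [injective_iff_map_eq_zero]
    intro r hr
    ext k
    apply hC.1
    ext c
    have := LinearMap.congr_fun hr (Pi.single k c)
    simpa [σ, Fintype.linearCombination_apply, Pi.single_apply] using this
  have : Module.FinitePresentation R ((Fin S.n → C) →ₗ[R] C) :=
    .of_equiv (LinearEquiv.ofBijective (σ S.n) ⟨hσinj, hσ _⟩)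
  have hfin : ∀ n, Module.Finite R ((Fin n → C) →ₗ[R] C) := fun n => .of_surjective _ (hσ n)
  have : Module.Finite R ((Fin S.m → C) × (Fin S.n → C) →ₗ[R] C) :=
    .equiv (LinearMap.coprodEquiv (M := Fin S.m → C) (M₂ := Fin S.n → C) (M₃ := C) R (R := R))
  refine Module.finitePresentation_of_surjective α hα ?_
  have : LinearMap.ker α = LinearMap.range (S.b.lcomp R C) := by
    ext φ
    constructor
    · intro h
      obtain ⟨ψ, hψ⟩ := S.factor φ (LinearMap.congr_fun h)
      exact ⟨ψ, LinearMap.ext hψ⟩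
    · rintro ⟨ψ, rfl⟩
      ext x
      simp [α, S.exact.apply_apply_eq_zero]
  rw [this]
  exact Submodule.fg_range _

end FiniteCopresentation

end Duality

/-! ### From vanishing `Ext` to `Hom`-exact resolutions -/

section ExtVanishing

variable {R : Type u} [CommRing R]

open CategoryTheory

/-- Dimension shifting: for `0 → K → P → Z → 0` with `P` projective and `Extⁱ(Z, N) = 0` for all
`i ≥ 1`, also `Extⁱ(K, N) = 0` for all `i ≥ 1`, and every map `K → N` extends to `P`. -/
lemma ext_shift {K P Z N : Type u} [AddCommGroup K] [Module R K] [AddCommGroup P] [Module R P]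
    [AddCommGroup Z] [Module R Z] [AddCommGroup N] [Module R N] [Module.Projective R P]
    (f : K →ₗ[R] P) (g : P →ₗ[R] Z) (hf : Function.Injective f) (hg : Function.Surjective g)
    (hfg : Function.Exact f g)
    (hZ : ∀ i : ℕ, 1 ≤ i →
      Subsingleton (Abelian.Ext.{u} (ModuleCat.of R Z) (ModuleCat.of R N) i)) :
    (∀ i : ℕ, 1 ≤ i → Subsingleton (Abelian.Ext.{u} (ModuleCat.of R K) (ModuleCat.of R N) i)) ∧
    ∀ φ : K →ₗ[R] N, ∃ ψ : P →ₗ[R] N, ∀ x, ψ (f x) = φ x := by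
  let S : ShortComplex (ModuleCat.{u} R) := ShortComplex.mk (ModuleCat.ofHom f) (ModuleCat.ofHom g)
    (by ext x; exact hfg.apply_apply_eq_zero x)
  have hS : S.ShortExact :=
    { exact := (ShortComplex.ShortExact.moduleCat_exact_iff_function_exact S).mpr hfg
      mono_f := (ModuleCat.mono_iff_injective _).mpr hf
      epi_g := (ModuleCat.epi_iff_surjective _).mpr hg }
  have hP : Projective (ModuleCat.of R P) := ModuleCat.projective_of_categoryTheory_projective _
  constructor
  · intro i hi
    refine subsingleton_of_forall_eq 0 fun x => ?_
    have := hZ (1 + i) (by omega)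
    obtain ⟨y, rfl⟩ := Abelian.Ext.contravariant_sequence_exact₁ hS _ x rfl
      (Subsingleton.elim _ _)
    obtain ⟨j, rfl⟩ := Nat.exists_eq_add_of_le' hi
    have : y = 0 := Abelian.Ext.eq_zero_of_projective (P := ModuleCat.of R P) y
    rw [this, Abelian.Ext.comp_zero]
  · intro φ
    have := hZ 1 le_rfl
    obtain ⟨y, hy⟩ := Abelian.Ext.contravariant_sequence_exact₁ hS _
      (Abelian.Ext.mk₀ (ModuleCat.ofHom φ)) rfl (Subsingleton.elim _ _)
    obtain ⟨ψ, rfl⟩ := (Abelian.Ext.mk₀_bijective _ _).2 y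
    rw [Abelian.Ext.mk₀_comp_mk₀] at hy
    have h := (Abelian.Ext.mk₀_bijective _ _).1 hy
    exact ⟨ψ.hom, fun x => congrArg (fun t => t.hom x) h⟩

lemma LinearMap.exists_factor_of_surjective {B Z N : Type u} [AddCommGroup B] [Module R B]
    [AddCommGroup Z] [Module R Z] [AddCommGroup N] [Module R N] (p : B →ₗ[R] Z)
    (hp : Function.Surjective p) (φ : B →ₗ[R] N) (h : ∀ x, p x = 0 → φ x = 0) :
    ∃ ψ : Z →ₗ[R] N, ∀ b, ψ (p b) = φ b := by
  refine ⟨(LinearMap.ker p).liftQ φ h ∘ₗ (p.quotKerEquivOfSurjective hp).symm.toLinearMap,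
    fun b => ?_⟩
  have : (p.quotKerEquivOfSurjective hp).symm (p b) = Submodule.Quotient.mk b := by
    rw [LinearEquiv.symm_apply_eq]
    rfl
  rw [LinearMap.comp_apply, LinearEquiv.coe_coe, this]
  exact Submodule.liftQ_apply _ _ _

/-- If `Extⁱ(C, N) = 0` for all `i ≥ 1`, then `Hom(-, N)` keeps projective resolutions of `C`
exact. -/
lemma contraHomExact_of_ext_eq_zero {C N : Type u} [AddCommGroup C] [Module R C] [AddCommGroup N]
    [Module R N] (P : ℕ → ModuleCat.{u} R) (d : ∀ n, P (n + 1) →ₗ[R] P n) (ε : P 0 →ₗ[R] C)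
    (hP : ∀ n, Module.Projective R (P n)) (hε : Function.Surjective ε)
    (h0 : Function.Exact (d 0) ε) (hd : ∀ n, Function.Exact (d (n + 1)) (d n))
    (hC : ∀ i : ℕ, 1 ≤ i →
      Subsingleton (Abelian.Ext.{u} (ModuleCat.of R C) (ModuleCat.of R N) i)) :
    ContraHomExact R N (d 0) ε ∧ ∀ n, ContraHomExact R N (d (n + 1)) (d n) := by
  have hbase := ext_shift (N := N) (LinearMap.range (d 0)).subtype ε Subtype.val_injective hε
    (fun x => by rw [h0 x]; simp) hC
  have hstep := fun n => ext_shift (N := N) (LinearMap.range (d (n + 1))).subtype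
    (d n).rangeRestrict Subtype.val_injective (d n).surjective_rangeRestrict
    (fun x => by
      rw [← Subtype.coe_inj]
      simpa using hd n x)
  -- Dimension shifting along the syzygies `range (d n)`.
  have hall : ∀ n, (∀ i : ℕ, 1 ≤ i → Subsingleton
      (Abelian.Ext.{u} (ModuleCat.of R (LinearMap.range (d n))) (ModuleCat.of R N) i)) ∧
      ∀ φ : LinearMap.range (d n) →ₗ[R] N, ∃ ψ : P n →ₗ[R] N, ∀ x, ψ x.1 = φ x := by
    intro n
    induction n with
    | zero => exact hbase
    | succ n ih => exact hstep n ih.1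
  constructor
  · refine contraHomExact_of_exact h0 fun φ hφ => ?_
    refine LinearMap.exists_factor_of_surjective ε hε φ fun x hx => ?_
    obtain ⟨y, rfl⟩ := (h0 x).mp hx
    exact hφ y
  · intro n
    refine contraHomExact_of_exact (hd n) fun φ hφ => ?_
    obtain ⟨ψ, hψ⟩ := LinearMap.exists_factor_of_surjective (d n).rangeRestrict
      (d n).surjective_rangeRestrict φ fun x hx => by
        obtain ⟨y, rfl⟩ := (hd n x).mp (congrArg Subtype.val hx)
        exact hφ y
    obtain ⟨χ, hχ⟩ := (hall n).2 ψ
    exact ⟨χ, fun b => (hχ ((d n).rangeRestrict b)).trans (hψ b)⟩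

end ExtVanishing

/-! ### `C`-duality for finitely generated projectives -/

section Evaluation

variable {R : Type u} [CommRing R] {C : Type u} [AddCommGroup C] [Module R C]
variable {P : Type u} [AddCommGroup P] [Module R P] [Module.Finite R P] [Module.Projective R P]

/-- `P` is a retract of `R^n`, and a map `Hom(R^n, C) = C^n → C` has coefficients `r`, hence is
evaluation at `r`. -/
lemma exists_eq_eval_of_homothety
    (hC : Function.Bijective (LinearMap.lsmul R C : R →ₗ[R] C →ₗ[R] C))
    (φ : (P →ₗ[R] C) →ₗ[R] C) :
    ∃ p : P, ∀ f : P →ₗ[R] C, φ f = f p := by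
  obtain ⟨n, q, i, -, -, hqi⟩ := Module.Finite.exists_comp_eq_id_of_projective R P
  obtain ⟨r, hr⟩ := exists_smul_of_homothety hC
    (φ ∘ₗ i.lcomp R C ∘ₗ (LinearEquiv.piRing R C (Fin n) R).symm.toLinearMap)
  refine ⟨q r, fun f => ?_⟩
  have h1 := hr (LinearEquiv.piRing R C (Fin n) R (f ∘ₗ q))
  have h2 : i.lcomp R C (f ∘ₗ q) = f := by
    ext x
    exact congrArg f (LinearMap.congr_fun hqi x)
  simp only [LinearMap.comp_apply, LinearEquiv.coe_coe, LinearEquiv.symm_apply_apply, h2] at h1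
  rw [h1, ← LinearMap.comp_apply f q r]
  conv_rhs => rw [← (LinearEquiv.piRing R C (Fin n) R).symm_apply_apply (f ∘ₗ q)]
  rw [LinearEquiv.piRing_symm_apply]

lemma eq_zero_of_forall_hom_eq_zero
    (hC : Function.Bijective (LinearMap.lsmul R C : R →ₗ[R] C →ₗ[R] C))
    (p : P) (hp : ∀ f : P →ₗ[R] C, f p = 0) : p = 0 := by
  obtain ⟨n, q, i, -, hi, -⟩ := Module.Finite.exists_comp_eq_id_of_projective R P
  apply hi
  rw [map_zero]
  ext k
  apply hC.1
  ext c
  simpa using hp ((LinearMap.toSpanSingleton R C c) ∘ₗ LinearMap.proj k ∘ₗ i)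

end Evaluation

/-! ### Exactness under isomorphisms and finite powers -/

section Transport

variable {R : Type u} [CommRing R] {A B D B' D' N : Type u} [AddCommGroup A] [Module R A]
  [AddCommGroup B] [Module R B] [AddCommGroup D] [Module R D] [AddCommGroup B'] [Module R B']
  [AddCommGroup D'] [Module R D'] [AddCommGroup N] [Module R N]
  {f : A →ₗ[R] B} {g : B →ₗ[R] D}

lemma ContraHomExact.comp_equiv (h : ContraHomExact R N f g) (t : D ≃ₗ[R] D') :
    ContraHomExact R N f (t.toLinearMap ∘ₗ g) := by
  rw [contraHomExact_iff] at h ⊢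
  refine ⟨fun ψ a => h.1 (ψ ∘ₗ t.toLinearMap) a, fun φ hφ => ?_⟩
  obtain ⟨ψ, hψ⟩ := h.2 φ hφ
  exact ⟨ψ ∘ₗ t.symm.toLinearMap, fun b => by simp [hψ]⟩

lemma ContraHomExact.conj_equiv (h : ContraHomExact R N f g) (s : B ≃ₗ[R] B') :
    ContraHomExact R N (s.toLinearMap ∘ₗ f) (g ∘ₗ s.symm.toLinearMap) := by
  rw [contraHomExact_iff] at h ⊢
  refine ⟨fun ψ a => by simpa using h.1 ψ a, fun φ hφ => ?_⟩
  obtain ⟨ψ, hψ⟩ := h.2 (φ ∘ₗ s.toLinearMap) hφ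
  exact ⟨ψ, fun b => by simp [hψ]⟩

lemma ContraHomExact.equiv_comp {A' : Type u} [AddCommGroup A'] [Module R A']
    (h : ContraHomExact R N f g) (s : A' ≃ₗ[R] A) :
    ContraHomExact R N (f ∘ₗ s.toLinearMap) g := by
  rw [contraHomExact_iff] at h ⊢
  refine ⟨fun ψ a => h.1 ψ (s a), fun φ hφ => h.2 φ fun a => ?_⟩
  simpa using hφ (s.symm a)

lemma Function.Exact.linear_comp_equiv (h : Function.Exact f g) (t : D ≃ₗ[R] D') :
    Function.Exact f (t.toLinearMap ∘ₗ g) := fun b => by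
  rw [← h b]
  simp

lemma Function.Exact.linear_conj_equiv (h : Function.Exact f g) (s : B ≃ₗ[R] B') :
    Function.Exact (s.toLinearMap ∘ₗ f) (g ∘ₗ s.symm.toLinearMap) := fun b => by
  have := h (s.symm b)
  rw [LinearMap.comp_apply, LinearEquiv.coe_coe, this]
  simp [LinearEquiv.eq_symm_apply]

lemma Function.Exact.linear_equiv_comp {A' : Type u} [AddCommGroup A'] [Module R A']
    (h : Function.Exact f g) (s : A' ≃ₗ[R] A) :
    Function.Exact (f ∘ₗ s.toLinearMap) g := fun b => by
  rw [h b]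
  exact ⟨fun ⟨a, ha⟩ => ⟨s.symm a, by simp [ha]⟩, fun ⟨a, ha⟩ => ⟨s a, ha⟩⟩

lemma ContraHomExact.compLeft (h : ContraHomExact R N f g) (hfg : Function.Exact f g) (k : ℕ) :
    Function.Exact (f.compLeft (Fin k)) (g.compLeft (Fin k)) ∧
    ContraHomExact R N (f.compLeft (Fin k)) (g.compLeft (Fin k)) := by
  classical
  have hex : Function.Exact (f.compLeft (Fin k)) (g.compLeft (Fin k)) := by
    intro b
    constructor
    · intro hb
      choose a ha using fun i => (hfg (b i)).mp (congrFun hb i)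
      exact ⟨a, funext ha⟩
    · rintro ⟨a, rfl⟩
      exact funext fun i => hfg.apply_apply_eq_zero (a i)
  refine ⟨hex, contraHomExact_of_exact hex fun φ hφ => ?_⟩
  choose ψ hψ using fun i => (contraHomExact_iff.mp h).2 (φ ∘ₗ LinearMap.single R (fun _ => B) i)
    (fun a => by
      have := hφ (Pi.single i a)
      rw [← this]
      simp only [LinearMap.comp_apply, LinearMap.single_apply]
      congr 1
      ext j
      by_cases hj : j = i
      · subst hj; simp
      · simp [hj])
  refine ⟨∑ i, ψ i ∘ₗ LinearMap.proj i, fun b => ?_⟩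
  conv_rhs => rw [← Finset.univ_sum_single b, map_sum]
  simp only [LinearMap.sum_apply]
  exact Finset.sum_congr rfl fun i _ => hψ i (b i)

end Transport

/-! ### `C^k` and `R` are `G_C`-projective -/

section GCProjective

variable {R : Type u} [CommRing R] {C : Type u} [AddCommGroup C] [Module R C]

/-- The sequence of modules with `V` in degree zero and zero elsewhere. -/
def concentratedAtZero (R : Type u) [CommRing R] (V : Type u) [AddCommGroup V] [Module R V] :
    ℕ → ModuleCat.{u} R
  | 0 => ModuleCat.of R V
  | _ + 1 => ModuleCat.of R PUnit.{u + 1}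

lemma IsSemidualizing.finite (hC : IsSemidualizing R C) : Module.Finite R C := by
  obtain ⟨P, d, ε, hP, hε, -⟩ := hC.resolution
  have := (hP 0).1
  exact .of_surjective ε hε

/-- Finite powers of a semidualizing module `C` are `G_C`-projective. -/
lemma IsSemidualizing.isGCProjective_pi (hC : IsSemidualizing R C) (k : ℕ) :
    IsGCProjective R C (Fin k → C) := by
  have hfin := hC.finite
  obtain ⟨P, d, ε, hP, hε, h0, hd⟩ := hC.resolution
  have hfg := fun n => (hP n).1
  have hproj := fun n => (hP n).2
  obtain ⟨hc0, hcd⟩ := contraHomExact_of_ext_eq_zero P d ε hproj hε h0 hd hC.ext_eq_zero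
  let Q : ℕ → ModuleCat.{u} R := concentratedAtZero R (Fin k → R)
  let s : (Fin k → C) ≃ₗ[R] C ⊗[R] Q 0 := (TensorProduct.piScalarRight R R C (Fin k)).symm
  let e : (Fin k → P 0) →ₗ[R] C ⊗[R] Q 0 := s.toLinearMap ∘ₗ ε.compLeft (Fin k)
  have hεk : Function.Surjective (ε.compLeft (Fin k)) := fun c => by
    choose p hp using fun i => hε (c i)
    exact ⟨p, funext hp⟩
  have he : Function.Surjective e := s.surjective.comp hεk
  have hsub : ∀ n, Subsingleton (C ⊗[R] Q (n + 1)) := fun n =>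
    inferInstanceAs (Subsingleton (C ⊗[R] PUnit.{u + 1}))
  have hQfin : Module.Finite R (C ⊗[R] Q 0) :=
    inferInstanceAs (Module.Finite R (C ⊗[R] (Fin k → R)))
  have E0 : Function.Exact ((d 0).compLeft (Fin k)) e := (hc0.compLeft h0 k).1.linear_comp_equiv s
  have E1 : Function.Exact e (0 : C ⊗[R] Q 0 →ₗ[R] C ⊗[R] Q 1) := fun x =>
    ⟨fun _ => he x, fun _ => rfl⟩
  -- The complex is the `k`-th power of the resolution of `C`, continued by zero on the right.
  refine ⟨fun n => ModuleCat.of R (Fin k → P n), Q, fun n => (d n).compLeft (Fin k), e,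
    fun n => 0, fun n => ?_, ?_, ⟨fun n => ((hcd n).compLeft (hd n) k).1, E0, E1, ?_⟩, ?_, ?_⟩
  · exact .of_equiv (DFinsupp.linearEquivFunOnFintype (R := R) (ι := Fin k) (M := fun _ => P n))
  · rintro (_ | n)
    · exact inferInstanceAs (Module.Projective R (Fin k → R))
    · exact inferInstanceAs (Module.Projective R PUnit.{u + 1})
  · exact fun n x => ⟨fun _ => ⟨0, Subsingleton.elim _ _⟩, fun _ => rfl⟩
  · exact ⟨s ≪≫ₗ (LinearEquiv.ofTop _ (LinearMap.range_eq_top.mpr he)).symm⟩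
  · intro L _ _ hL
    refine ⟨fun n => ?_, ?_, ?_, fun n => ?_⟩
    · obtain ⟨h1, h2⟩ := (hcd n).compLeft (hd n) k
      exact h2.tensor h1 L
    · exact ((hc0.compLeft h0 k).2.comp_equiv s).tensor E0 L
    · refine contraHomExact_of_exact E1 fun φ hφ => ⟨0, fun b => ?_⟩
      obtain ⟨p, rfl⟩ := he b
      rw [hφ, LinearMap.zero_apply]
    · refine contraHomExact_iff.mpr ⟨fun ψ a => by simp, fun φ hφ => ⟨0, fun b => ?_⟩⟩
      rw [Subsingleton.elim b 0, map_zero, map_zero, map_zero]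

/-- The base ring is `G_C`-projective for a semidualizing module `C`. -/
lemma IsSemidualizing.isGCProjective_self (hC : IsSemidualizing R C) : IsGCProjective R C R := by
  have hfin := hC.finite
  have hom := hC.homothety
  obtain ⟨P, d, ε, hP, hε, h0, hd⟩ := hC.resolution
  have hfg := fun n => (hP n).1
  have hproj := fun n => (hP n).2
  obtain ⟨hc0, hcd⟩ := contraHomExact_of_ext_eq_zero P d ε hproj hε h0 hd hC.ext_eq_zero
  let F : ℕ → ModuleCat.{u} R := concentratedAtZero R R
  -- With this choice `C ⊗ Q n ≅ Hom(P n, C)`: the complex is `0 → R → Hom(P 0, C) → Hom(P 1, C) →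
  -- ⋯`, where `1 ↦ ε`. Dualizing it into `C` recovers the resolution, as each `P n` is
  -- `C`-reflexive.
  let Q : ℕ → ModuleCat.{u} R := fun n => ModuleCat.of R (Module.Dual R (P n))
  let s : ∀ n, (P n →ₗ[R] C) ≃ₗ[R] C ⊗[R] Q n := fun n =>
    (dualTensorHomEquiv (R := R) (M := P n) (N := C)).symm ≪≫ₗ TensorProduct.comm R _ _
  have hQfin : ∀ n, Module.Finite R (C ⊗[R] Q n) := fun n =>
    inferInstanceAs (Module.Finite R (C ⊗[R] Module.Dual R (P n)))
  let e' : R →ₗ[R] (P 0 →ₗ[R] C) := LinearMap.toSpanSingleton R _ ε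
  let δ' : ∀ n, (P n →ₗ[R] C) →ₗ[R] (P (n + 1) →ₗ[R] C) := fun n => (d n).lcomp R C
  have he'inj : ∀ r, e' r = 0 → r = 0 := fun r hr => by
    apply hom.1
    ext c
    obtain ⟨p, rfl⟩ := hε c
    simpa [e'] using LinearMap.congr_fun hr p
  have E0 : Function.Exact (0 : F 1 →ₗ[R] F 0) e' := fun r =>
    ⟨fun h => ⟨0, (he'inj r h).symm⟩, by rintro ⟨x, rfl⟩; exact map_zero e'⟩
  have E1 : Function.Exact e' (δ' 0) := by
    intro f
    constructor
    · intro hf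
      obtain ⟨ψ, hψ⟩ := (contraHomExact_iff.mp hc0).2 f (LinearMap.congr_fun hf)
      obtain ⟨r, rfl⟩ := hom.2 ψ
      exact ⟨r, LinearMap.ext hψ⟩
    · rintro ⟨r, rfl⟩
      ext x
      simp [e', δ', h0.apply_apply_eq_zero]
  have E2 : ∀ n, Function.Exact (δ' n) (δ' (n + 1)) := hcd
  have D0 : ContraHomExact R C (0 : F 1 →ₗ[R] F 0) e' := by
    refine contraHomExact_of_exact E0 fun φ _ => ?_
    let φ' : R →ₗ[R] C := φ
    obtain ⟨p, hp⟩ := hε (φ' 1)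
    refine ⟨LinearMap.applyₗ p, fun (r : R) => ?_⟩
    change r • ε p = φ' r
    rw [hp, ← map_smul, smul_eq_mul, mul_one]
  have D1 : ContraHomExact R C e' (δ' 0) := by
    refine contraHomExact_of_exact E1 fun φ hφ => ?_
    obtain ⟨p, hp⟩ := exists_eq_eval_of_homothety hom φ
    have h1 : ε p = 0 := by simpa [e', hp] using hφ 1
    obtain ⟨q, rfl⟩ := (h0 p).mp h1
    exact ⟨LinearMap.applyₗ q, fun f => (hp f).symm⟩
  have D2 : ∀ n, ContraHomExact R C (δ' n) (δ' (n + 1)) := by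
    intro n
    refine contraHomExact_of_exact (E2 n) fun φ hφ => ?_
    obtain ⟨p, hp⟩ := exists_eq_eval_of_homothety hom φ
    have h1 : d n p = 0 := eq_zero_of_forall_hom_eq_zero hom _ fun f => by
      simpa [δ', hp] using hφ f
    obtain ⟨q, rfl⟩ := (hd n p).mp h1
    exact ⟨LinearMap.applyₗ q, fun f => (hp f).symm⟩
  let e : F 0 →ₗ[R] C ⊗[R] Q 0 := (s 0).toLinearMap ∘ₗ e'
  let δ : ∀ n, C ⊗[R] Q n →ₗ[R] C ⊗[R] Q (n + 1) := fun n =>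
    ((s (n + 1)).toLinearMap ∘ₗ δ' n) ∘ₗ (s n).symm.toLinearMap
  have X0 : Function.Exact (0 : F 1 →ₗ[R] F 0) e := E0.linear_comp_equiv (s 0)
  have X1 : Function.Exact e (δ 0) := (E1.linear_comp_equiv (s 1)).linear_conj_equiv (s 0)
  have X2 : ∀ n, Function.Exact (δ n) (δ (n + 1)) := fun n =>
    (((E2 n).linear_comp_equiv (s (n + 2))).linear_conj_equiv (s (n + 1))).linear_equiv_comp
      (s n).symm
  have heinj : Function.Injective e := (s 0).injective.comp
    ((injective_iff_map_eq_zero e').mpr he'inj)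
  have hsub : ∀ n, Subsingleton (F (n + 1)) := fun n => inferInstanceAs (Subsingleton PUnit.{u + 1})
  have hF0 : Module.Finite R (F 0) := inferInstanceAs (Module.Finite R R)
  refine ⟨F, Q, fun n => 0, e, δ, ?_, fun n => ?_, ⟨fun n x => ?_, X0, X1, X2⟩, ?_, ?_⟩
  · rintro (_ | n)
    · exact inferInstanceAs (Module.Projective R R)
    · exact inferInstanceAs (Module.Projective R PUnit.{u + 1})
  · exact inferInstanceAs (Module.Projective R (Module.Dual R (P n)))
  · exact ⟨fun _ => ⟨0, Subsingleton.elim _ _⟩, fun _ => rfl⟩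
  · exact ⟨LinearEquiv.ofInjective e heinj⟩
  · intro L _ _ hL
    refine ⟨fun n => ?_, ?_, ?_, fun n => ?_⟩
    · refine contraHomExact_iff.mpr ⟨fun ψ a => by simp, fun φ hφ => ⟨0, fun b => ?_⟩⟩
      rw [Subsingleton.elim b 0, map_zero, map_zero, map_zero]
    · exact (D0.comp_equiv (s 0)).tensor X0 L
    · exact ((D1.comp_equiv (s 1)).conj_equiv (s 0)).tensor X1 L
    · exact ((((D2 n).comp_equiv (s (n + 2))).conj_equiv (s (n + 1))).equiv_comp
        (s n).symm).tensor (X2 n) L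

end GCProjective

/-! ### Finite free resolutions over coherent rings -/

section Coherent

variable {R : Type u} [CommRing R]

/-- Over a coherent ring, finitely generated submodules of finite free modules are finitely
presented. -/
lemma IsCoherentRing.finitePresentation_of_fg (hR : IsCoherentRing R) (n : ℕ)
    (N : Submodule R (Fin n → R)) (hN : N.FG) : Module.FinitePresentation R N := by
  induction n with
  | zero =>
    have : Subsingleton N := inferInstance
    exact Module.finitePresentation_of_projective R N
  | succ n ih =>
    -- `N` is an extension of the ideal `range p` by `ker p`, which embeds in `R^n` by dropping
    -- coordinate `0`.
    let p : N →ₗ[R] R := LinearMap.proj 0 ∘ₗ N.subtype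
    have := Module.Finite.iff_fg.mpr hN
    have : Module.FinitePresentation R (LinearMap.range p) := hR _ (Submodule.fg_range p)
    let t : LinearMap.ker p →ₗ[R] (Fin n → R) :=
      LinearMap.funLeft R R Fin.succ ∘ₗ N.subtype ∘ₗ (LinearMap.ker p).subtype
    have ht : Function.Injective t := by
      intro x y hxy
      apply Subtype.ext
      apply Subtype.ext
      funext k
      refine Fin.cases ?_ (fun k => congrFun hxy k) k
      exact (LinearMap.mem_ker.mp x.2).trans (LinearMap.mem_ker.mp y.2).symm
    have hker : (LinearMap.ker p).FG := by
      rw [← LinearMap.ker_rangeRestrict]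
      exact Module.FinitePresentation.fg_ker _ p.surjective_rangeRestrict
    have := Module.Finite.iff_fg.mpr hker
    have := ih (LinearMap.range t) (Submodule.fg_range t)
    have h1 : Module.FinitePresentation R (LinearMap.ker p) :=
      Module.FinitePresentation.of_equiv (M := LinearMap.range t) (N := LinearMap.ker p)
        (LinearEquiv.ofInjective t ht).symm
    rw [← LinearMap.ker_rangeRestrict] at h1
    exact Module.finitePresentation_of_ker p.rangeRestrict p.surjective_rangeRestrict

/-- One step of a resolution: the kernel is again finitely generated in a finite free module, so the
step can be iterated. -/
lemma IsCoherentRing.exists_cover (hR : IsCoherentRing R) {n : ℕ} (K : Submodule R (Fin n → R))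
    (hK : K.FG) : ∃ (m : ℕ) (f : (Fin m → R) →ₗ[R] (Fin n → R)),
      LinearMap.range f = K ∧ (LinearMap.ker f).FG := by
  have := hR.finitePresentation_of_fg n K hK
  obtain ⟨m, f, hf⟩ := Module.Finite.exists_fin' R K
  refine ⟨m, K.subtype ∘ₗ f, ?_, ?_⟩
  · rw [LinearMap.range_comp, LinearMap.range_eq_top.mpr hf, Submodule.map_top,
      Submodule.range_subtype]
  · rw [LinearMap.ker_comp, Submodule.ker_subtype]
    exact Module.FinitePresentation.fg_ker f hf

lemma inGenStar_self_of_finite_free_resolution {M : Type u} [AddCommGroup M] [Module R M]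
    (k : ℕ → ℕ) (d : ∀ n, (Fin (k (n + 1)) → R) →ₗ[R] (Fin (k n) → R))
    (ε : (Fin (k 0) → R) →ₗ[R] M) (hε : Function.Surjective ε) (h0 : Function.Exact (d 0) ε)
    (hd : ∀ n, Function.Exact (d (n + 1)) (d n)) : InGenStar R R M := by
  have lift : ∀ {A B D : Type u} [AddCommGroup A] [Module R A] [AddCommGroup B] [Module R B]
      [AddCommGroup D] [Module R D] (f : A →ₗ[R] B) (g : B →ₗ[R] D), Function.Exact f g →
      CoHomExact R R f g := by
    intro A B D _ _ _ _ _ _ f g hfg φ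
    constructor
    · intro h
      obtain ⟨a, ha⟩ := (hfg (φ 1)).mp (LinearMap.congr_fun h 1)
      exact ⟨LinearMap.toSpanSingleton R A a, by ext; simp [ha]⟩
    · rintro ⟨ψ, rfl⟩
      ext
      simp [hfg.apply_apply_eq_zero]
  refine ⟨fun n => ModuleCat.of R (Fin (k n) → R), d, ε,
    fun n => ⟨k n, LinearMap.id, LinearMap.id, rfl⟩, ⟨hε, h0, hd⟩, fun φ => ?_,
    lift _ _ h0, fun n => lift _ _ (hd n)⟩
  obtain ⟨x, hx⟩ := hε (φ 1)
  exact ⟨LinearMap.toSpanSingleton R _ x, by ext; simp [hx]⟩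

/-- Over a coherent ring, finitely presented modules have resolutions by finite free modules. -/
lemma IsCoherentRing.inGenStar (hR : IsCoherentRing R) (M : Type u) [AddCommGroup M] [Module R M]
    [Module.FinitePresentation R M] : InGenStar R R M := by
  obtain ⟨k₀, ε, hε⟩ := Module.Finite.exists_fin' R M
  have hker := Module.FinitePresentation.fg_ker ε hε
  choose! m f hf hfK using fun (n : ℕ) (K : Submodule R (Fin n → R)) => hR.exists_cover K
  let K : ℕ → Σ n : ℕ, {K : Submodule R (Fin n → R) // K.FG} := fun j =>
    Nat.rec ⟨k₀, LinearMap.ker ε, hker⟩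
      (fun _ K => ⟨m K.1 K.2.1, LinearMap.ker (f K.1 K.2.1), hfK _ _ K.2.2⟩) j
  refine inGenStar_self_of_finite_free_resolution (fun j => (K j).1)
    (fun j => f (K j).1 (K j).2.1) ε hε ?_ fun j => ?_
  · exact LinearMap.exact_iff.mpr (hf _ _ hker).symm
  · exact LinearMap.exact_iff.mpr (hf _ _ (K (j + 1)).2.2).symm

end Coherent

/-- If finitely generated submodules of `G_C`-projective modules are `G_C`-projective, then finitely
generated `G_C`-projective modules are finitely presented and `C`-reflexive. -/
lemma IsSemidualizing.bijective_and_finitePresentation {R : Type u} [CommRing R] {C : Type u} [AddCommGroup C]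
    [Module R C] (hC : IsSemidualizing R C)
    (h : ∀ (G : Type u) [AddCommGroup G] [Module R G], IsGCProjective R C G →
      ∀ N : Submodule R G, N.FG → IsGCProjective R C N)
    (M : Type u) [AddCommGroup M] [Module R M] [Module.Finite R M] (hM : IsGCProjective R C M) :
    Function.Bijective (bidualityMap R C M) ∧ Module.FinitePresentation R M := by
  have := hC.finite
  obtain ⟨S⟩ := hM.exists_finiteCopresentation
  have hbi := S.biduality_bijective hC.homothety
  refine ⟨hbi, ?_⟩
  have := S.dual_finitePresentation hC.homothety
  obtain ⟨k, q, hq⟩ := Module.Finite.exists_fin' R M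
  let ι : (M →ₗ[R] C) →ₗ[R] (Fin k → C) :=
    (LinearEquiv.piRing R C (Fin k) R).toLinearMap ∘ₗ q.lcomp R C
  have hι : Function.Injective ι := (LinearEquiv.piRing R C (Fin k) R).injective.comp
    fun f g (hfg : f ∘ₗ q = g ∘ₗ q) => LinearMap.ext fun x => by
      obtain ⟨y, rfl⟩ := hq x
      exact LinearMap.congr_fun hfg y
  obtain ⟨S'⟩ := (h _ (hC.isGCProjective_pi k) _
    (Submodule.fg_range ι)).exists_finiteCopresentation
  have := S'.dual_finitePresentation hC.homothety
  -- `M^C ≅ range ι`, so `M^CC` is the dual of `range ι`.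
  have : Module.FinitePresentation R ((M →ₗ[R] C) →ₗ[R] C) :=
    .of_equiv (LinearEquiv.congrLeft C R (LinearEquiv.ofInjective ι hι).symm)
  exact .of_equiv (LinearEquiv.ofBijective _ hbi).symm

theorem theorem3p2 (R : Type u) [CommRing R] (C : Type u) [AddCommGroup C] [Module R C]
    (hC : IsSemidualizing R C)
    (h : ∀ (G : Type u) [AddCommGroup G] [Module R G], IsGCProjective R C G →
      ∀ N : Submodule R G, N.FG → IsGCProjective R C N) :
    IsCoherentRing R ∧
      ∀ M : Ideal R, M.FG →
        Function.Bijective (bidualityMap R C M) ∧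
        InGenStar R R ((M →ₗ[R] C) →ₗ[R] C) := by
  have key : ∀ M : Ideal R, M.FG →
      Function.Bijective (bidualityMap R C M) ∧ Module.FinitePresentation R M := fun M hM => by
    have := Module.Finite.iff_fg.mpr hM
    exact hC.bijective_and_finitePresentation h M (h R hC.isGCProjective_self M hM)
  have hR : IsCoherentRing R := fun M hM => (key M hM).2
  refine ⟨hR, fun M hM => ⟨(key M hM).1, ?_⟩⟩
  have := (key M hM).2
  have : Module.FinitePresentation R ((M →ₗ[R] C) →ₗ[R] C) :=
    .of_equiv (LinearEquiv.ofBijective _ (key M hM).1)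
  exact hR.inGenStar _
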